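/- Let $1\le k<n$ and let $\mathcal A=(H_1,\dots,H_n)$ be a central generic arrangement of $n$ hyperplanes in $\mathbb C^k$, i.e. $H_i=\{x:\langle a_i,x\rangle=0\}$ and any $m\le k$ of the $H_i$ intersect in codimension $m$. For $t\in\mathbb C^n$ put $H_i^{t_i}=\{x\in\mathbb C^k:\langle a_i,x\rangle=t_i\}$. For $L\subset[n]=\{1,\dots,n\}$ with $|L|=k+1$ let $D_L=\{t\in\mathbb C^n:\bigcap_{i\in L}H_i^{t_i}\ne\emptyset\}$, a hyperplane in $\mathbb C^n$, and for $S\subset[n]$ let $D_S=\bigcap_{L\subset S,\,|L|=k+1}D_L$. The discriminantal arrangement $\mathcal B(n,k,\mathcal A)$ consists of all $D_L$ with $|L|=k+1$; its intersection lattice consists of all intersections of the $D_L$ (including $\mathbb C^n$ as the empty intersection), ordered by reverse inclusion, and the rank of an element is its codimension in $\mathbb C^n$. The arrangement $\mathcal A$ is called very generic if it lies in the largest Zariski open subset $\mathcal Z$ of the space of central generic arrangements of $n$ hyperplanes in $\mathbb C^k$ on which the isomorphism type of the intersection lattice of $\mathcal B(n,k,\cdot)$ is constant, i.e. if it lies in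 some Zariski open subset on which this isomorphism type is constant; otherwise $\mathcal A$ is non-very generic. An element $X$ of the intersection lattice is a simple intersection of multiplicity $r$ if $X=\bigcap_{i=1}^r D_{L_i}$ for pairwise distinct $L_1,\dots,L_r\subset[n]$ with $|L_i|=k+1$, such that $\bigcap_{i\in I}D_{L_i}\ne D_S$ for every $I\subset\{1,\dots,r\}$ with $|I|\ge 2$ and every $S\subset[n]$ with $|S|>k+1$. **Proposition.** If the intersection lattice of $\mathcal B(n,k,\mathcal A)$ contains a simple intersection of multiplicity $r$ whose rank is strictly less than $r$, then $\mathcal A$ is non-very generic. -/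

import Mathlib

namespace Discriminantal

/-- The affine hyperplane `{x ∈ ℂᵏ | ⟨aᵢ, x⟩ = s}`. A central arrangement of `n` hyperplanes in `ℂᵏ`
is given by the tuple `a` of its normal vectors, its `i`-th member is `hyperplane a i 0`, and the
parallel translates of that member are the `hyperplane a i s` with `s ∈ ℂ`. -/
def hyperplane {n k : ℕ} (a : Fin n → Fin k → ℂ) (i : Fin n) (s : ℂ) : Set (Fin k → ℂ) :=
  {x | a i ⬝ᵥ x = s}

/-- The `i`-th hyperplane of the central arrangement, as a linear subspace. -/
def centralHyperplane {n k : ℕ} (a : Fin n → Fin k → ℂ) (i : Fin n) :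
    Submodule ℂ (Fin k → ℂ) where
  carrier := hyperplane a i 0
  zero_mem' := by simp [hyperplane]
  add_mem' := by
    intro x y hx hy
    simp only [hyperplane, Set.mem_ofPred_eq] at *
    rw [dotProduct_add, hx, hy, add_zero]
  smul_mem' := by
    intro c x hx
    simp only [hyperplane, Set.mem_ofPred_eq] at *
    rw [dotProduct_smul, hx, smul_zero]

/-- Central generic arrangement: any `m ≤ k` of the hyperplanes meet in codimension `m`.
(With `m = 1` this says that every normal vector is nonzero.) -/
def IsCentralGeneric {n k : ℕ} (a : Fin n → Fin k → ℂ) : Prop :=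
  ∀ K : Finset (Fin n), K.card ≤ k →
    Module.finrank ℂ ↥(⨅ i ∈ K, centralHyperplane a i) + K.card = k

/-- The set `D_L` of those parallel translates `(H_1^{t_1}, …, H_n^{t_n})`, identified with
`t ∈ ℂⁿ`, whose members indexed by `L` have a common point. For a central generic arrangement and
`|L| = k + 1` this is a hyperplane, and it says that the translates indexed by `L` fail to be in
general position. -/
def discriminantalHyperplane {n k : ℕ} (a : Fin n → Fin k → ℂ) (L : Finset (Fin n)) :
    Submodule ℂ (Fin n → ℂ) where
  carrier := {t | (⋂ i ∈ L, hyperplane a i (t i)).Nonempty}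
  zero_mem' := ⟨0, by simp [hyperplane]⟩
  add_mem' := by
    rintro t u ⟨x, hx⟩ ⟨y, hy⟩
    refine ⟨x + y, ?_⟩
    simp only [hyperplane, Set.mem_iInter, Set.mem_ofPred_eq] at *
    intro i hi
    rw [dotProduct_add, hx i hi, hy i hi, Pi.add_apply]
  smul_mem' := by
    rintro c t ⟨x, hx⟩
    refine ⟨c • x, ?_⟩
    simp only [hyperplane, Set.mem_iInter, Set.mem_ofPred_eq] at *
    intro i hi
    rw [dotProduct_smul, hx i hi, Pi.smul_apply]

/-- `D_S`, the intersection of the `D_L` over all `(k + 1)`-element subsets `L` of `S`. -/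
def discriminantalFlat {n k : ℕ} (a : Fin n → Fin k → ℂ) (S : Finset (Fin n)) :
    Submodule ℂ (Fin n → ℂ) :=
  ⨅ L ∈ S.powersetCard (k + 1), discriminantalHyperplane a L

/-- The intersection lattice of the discriminantal arrangement: all intersections of hyperplanes
`D_L`, `|L| = k + 1`, the empty intersection (the whole space) included. -/
def intersectionLattice {n k : ℕ} (a : Fin n → Fin k → ℂ) : Set (Submodule ℂ (Fin n → ℂ)) :=
  {X | ∃ T : Finset (Finset (Fin n)), (∀ L ∈ T, L.card = k + 1) ∧
    X = ⨅ L ∈ T, discriminantalHyperplane a L}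

/-- The rank of an element of the intersection lattice is its codimension. -/
noncomputable def rank {n : ℕ} (X : Submodule ℂ (Fin n → ℂ)) : ℕ :=
  Module.finrank ℂ ((Fin n → ℂ) ⧸ X)

/-- `X` is a simple intersection of multiplicity `r`: it is the intersection of `r` hyperplanes
`D_L`, `L ∈ T`, and no two or more of them intersect in a `D_S` with `|S| > k + 1`. -/
def IsSimpleIntersection {n k : ℕ} (a : Fin n → Fin k → ℂ) (X : Submodule ℂ (Fin n → ℂ))
    (r : ℕ) : Prop :=
  ∃ T : Finset (Finset (Fin n)), T.card = r ∧ (∀ L ∈ T, L.card = k + 1) ∧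
    X = ⨅ L ∈ T, discriminantalHyperplane a L ∧
    ∀ I ⊆ T, 2 ≤ I.card → ∀ S : Finset (Fin n), k + 1 < S.card →
      ⨅ L ∈ I, discriminantalHyperplane a L ≠ discriminantalFlat a S

/-- `U` is a Zariski open subset of the space of central generic arrangements of `n` hyperplanes
in `ℂᵏ`: it is cut out there by the non-vanishing of some member of a family of polynomials in the
coordinates of the normal vectors. -/
def IsZariskiOpen {n k : ℕ} (U : Set (Fin n → Fin k → ℂ)) : Prop :=
  ∃ P : Set (MvPolynomial (Fin n × Fin k) ℂ),
    U = {a | IsCentralGeneric a ∧ ∃ p ∈ P, MvPolynomial.eval (fun ij => a ij.1 ij.2) p ≠ 0}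

/-- The very generic locus: the largest Zariski open subset of the space of central generic
arrangements on which the isomorphism type of the intersection lattice of the discriminantal
arrangement does not change, written as the union of all such subsets. Order isomorphisms for
inclusion and for reverse inclusion are the same maps. Rescaling normal vectors does not change the
isomorphism type, so it makes no difference whether the open sets are required to be stable
under rescaling, that is, to come from the space of tuples of hyperplanes. -/
def veryGenericLocus (n k : ℕ) : Set (Fin n → Fin k → ℂ) :=
  ⋃₀ {U | IsZariskiOpen U ∧
    ∀ a ∈ U, ∀ b ∈ U, Nonempty (↥(intersectionLattice a) ≃o ↥(intersectionLattice b))}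

/-- Very generic central arrangements. -/
def IsVeryGeneric {n k : ℕ} (a : Fin n → Fin k → ℂ) : Prop :=
  a ∈ veryGenericLocus n k

end Discriminantal

/-! Call a family of hyperplanes D_L independent if each is irredundant. If m ≥ 1 independent D_L
have union of index sets S, then m ≤ rank D_S ≤ |S| - k, so independent families satisfy the Hall
condition `IsHall`. For a very generic arrangement the converse holds
(`IsVeryGeneric.isIndep_of_isHall`). Indeed, each Hall family is independent for some configuration
(`IsHall.exists_surjective`), and this is witnessed by a nonvanishing polynomial. Hence some
arrangement b in the same Zariski open set has all Hall families independent, and a lattice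
isomorphism preserves the number of independent families.

A simple intersection of rank less than r comes from a dependent family, hence from one violating
Hall. A smallest violating subfamily J, with union S, loses only one member to become independent.
So its intersection has rank at least |J| - 1 ≥ |S| - k, and it equals D_S, against simplicity
(`IsCentralGeneric.exists_inter_eq_flat`). -/

namespace Discriminantal

open Matrix

/-! ### Surjectivity of polynomial matrices as an open condition. -/

/-- Over a field, a matrix is onto as a map of column vectors iff it is injective on row vectors. -/
theorem mulVec_surjective_iff_vecMul_injective {m p : Type*} [Fintype m] [Fintype p]
    (M : Matrix m p ℂ) : Function.Surjective M.mulVec ↔ Function.Injective M.vecMul := by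
  classical
  constructor
  · intro h
    obtain ⟨B, hB⟩ := Matrix.mulVec_surjective_iff_exists_right_inverse.1 h
    intro v w hvw
    have : (v ᵥ* M) ᵥ* B = (w ᵥ* M) ᵥ* B := congrArg (· ᵥ* B) hvw
    simpa [Matrix.vecMul_vecMul, hB] using this
  · intro h
    have hr := (Matrix.vecMul_injective_iff.1 h).rank_matrix
    have : LinearMap.range M.mulVecLin = ⊤ := by
      apply Submodule.eq_top_of_finrank_eq
      rw [Module.finrank_fintype_fun_eq_card]
      exact hr
    exact LinearMap.range_eq_top.1 this

/-- Surjectivity of a matrix with polynomial entries is a Zariski open condition. -/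
theorem exists_polynomial_of_surjective {σ m p : Type*} [Fintype m] [Fintype p]
    (A : Matrix m p (MvPolynomial σ ℂ)) (c : σ → ℂ)
    (h : Function.Surjective (A.map (MvPolynomial.eval c)).mulVec) :
    ∃ q : MvPolynomial σ ℂ, q ≠ 0 ∧ ∀ c' : σ → ℂ, MvPolynomial.eval c' q ≠ 0 →
      Function.Surjective (A.map (MvPolynomial.eval c')).mulVec := by
  classical
  obtain ⟨R, hR⟩ := Matrix.mulVec_surjective_iff_exists_right_inverse.1 h
  -- A right inverse at `c`, frozen as a constant matrix, makes det (A Q) equal to 1 at `c`; where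
  -- this polynomial is nonzero, A is still onto.
  obtain ⟨Q, hQ⟩ : ∃ Q : Matrix p m (MvPolynomial σ ℂ), ∀ c', Q.map (MvPolynomial.eval c') = R :=
    ⟨R.map MvPolynomial.C, fun c' => by ext i j; simp⟩
  have key : ∀ c' : σ → ℂ, MvPolynomial.eval c' (A * Q).det =
      (A.map (MvPolynomial.eval c') * R).det := by
    intro c'
    rw [RingHom.map_det, RingHom.mapMatrix_apply, Matrix.map_mul, hQ]
  refine ⟨(A * Q).det, ?_, ?_⟩
  · intro h0
    have := key c
    rw [hR, h0] at this
    simp at this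
  · intro c' hc'
    rw [key] at hc'
    have hu : IsUnit (A.map (MvPolynomial.eval c') * R) := by
      rw [Matrix.isUnit_iff_isUnit_det]
      exact hc'.isUnit
    intro w
    obtain ⟨v, hv⟩ := Matrix.mulVec_surjective_iff_isUnit.2 hu w
    exact ⟨R *ᵥ v, by rw [Matrix.mulVec_mulVec]; exact hv⟩

/-- Finitely many nonzero polynomials have a common point of non-vanishing. -/
theorem exists_forall_eval_ne_zero {σ ι : Type*} (s : Finset ι) (q : ι → MvPolynomial σ ℂ)
    (hq : ∀ i ∈ s, q i ≠ 0) : ∃ c : σ → ℂ, ∀ i ∈ s, MvPolynomial.eval c (q i) ≠ 0 := by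
  have hp : ∏ i ∈ s, q i ≠ 0 := Finset.prod_ne_zero_iff.2 hq
  by_contra! hcon
  apply hp
  apply MvPolynomial.funext
  intro c
  obtain ⟨i, hi, h0⟩ := hcon c
  rw [map_prod, map_zero]
  exact Finset.prod_eq_zero hi h0

/-! ### Hall's theorem and configurations with prescribed relations. -/

/-- If every `|J|` of the sets `A i` cover at least `|J| + k` points, there is a matrix whose rows
are supported on the `A i` and which stays of full row rank when any `k` columns are deleted. -/
theorem exists_matrix_of_hall {ι : Type*} [Fintype ι] {n k : ℕ} (A : ι → Finset (Fin n))
    (hA : ∀ J : Finset ι, J.Nonempty → J.card + k ≤ (J.biUnion A).card) :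
    ∃ M : Matrix ι (Fin n) ℂ, (∀ i, ∀ j ∉ A i, M i j = 0) ∧
      ∀ K : Finset (Fin n), K.card = k → ∀ v : ι → ℂ, (∀ j ∉ K, (v ᵥ* M) j = 0) → v = 0 := by
  classical
  let P : (K : Finset (Fin n)) → Matrix ι {j // j ∉ K} (MvPolynomial (ι × Fin n) ℂ) :=
    fun K => Matrix.of fun i j => if j.1 ∈ A i then MvPolynomial.X (i, j.1) else 0
  have hpt : ∀ K ∈ (Finset.univ.powersetCard k : Finset (Finset (Fin n))),
      ∃ c : ι × Fin n → ℂ, Function.Surjective ((P K).map (MvPolynomial.eval c)).mulVec := by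
    intro K hK
    have hKc : K.card = k := (Finset.mem_powersetCard.1 hK).2
    -- Deleting k points leaves the marriage condition, so there are distinct representatives f i
    -- outside K. The 0/1 point supported on the pairs (i, f i) then makes P K onto.
    have hall : ∀ J : Finset ι, J.card ≤ (J.biUnion fun i => A i \ K).card := by
      intro J
      rcases J.eq_empty_or_nonempty with rfl | hJ
      · simp
      · have h1 := hA J hJ
        have h2 : J.biUnion (fun i => A i \ K) = J.biUnion A \ K := by
          ext x; simp only [Finset.mem_biUnion, Finset.mem_sdiff]; tauto
        have h3 := Finset.le_card_sdiff K (J.biUnion A)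
        rw [h2]
        omega
    obtain ⟨f, hf, hfA⟩ :=
      (Finset.all_card_le_biUnion_card_iff_exists_injective fun i => A i \ K).1 hall
    have hfA' : ∀ i, f i ∈ A i ∧ f i ∉ K := fun i => Finset.mem_sdiff.1 (hfA i)
    refine ⟨fun ij => if f ij.1 = ij.2 then 1 else 0, ?_⟩
    rw [Matrix.mulVec_surjective_iff_exists_right_inverse]
    refine ⟨Matrix.of fun j i => if f i = j.1 then 1 else 0, ?_⟩
    ext i i'
    rw [Matrix.mul_apply, Finset.sum_eq_single (⟨f i', (hfA' i').2⟩ : {j // j ∉ K})]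
    · by_cases h : i = i'
      · subst h; simp [P, hfA' i]
      · have : f i ≠ f i' := fun h' => h (hf h')
        by_cases h2 : f i' ∈ A i <;> simp [P, h, this, h2]
    · intro j _ hj
      have : f i' ≠ j.1 := fun h => hj (Subtype.ext h.symm)
      simp [this]
    · simp
  have hq : ∀ K ∈ (Finset.univ.powersetCard k : Finset (Finset (Fin n))),
      ∃ q : MvPolynomial (ι × Fin n) ℂ, q ≠ 0 ∧ ∀ c' : ι × Fin n → ℂ,
        MvPolynomial.eval c' q ≠ 0 →
          Function.Surjective ((P K).map (MvPolynomial.eval c')).mulVec := by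
    intro K hK
    obtain ⟨c, hc⟩ := hpt K hK
    exact exists_polynomial_of_surjective (P K) c hc
  choose! q hq0 hq using hq
  obtain ⟨c, hc⟩ := exists_forall_eval_ne_zero _ q hq0
  refine ⟨Matrix.of fun i j => if j ∈ A i then c (i, j) else 0, ?_, ?_⟩
  · intro i j hj
    simp [hj]
  · intro K hK v hv
    have hKm : K ∈ (Finset.univ.powersetCard k : Finset (Finset (Fin n))) :=
      Finset.mem_powersetCard.2 ⟨Finset.subset_univ _, hK⟩
    have hinj := (mulVec_surjective_iff_vecMul_injective _).1 (hq K hKm c (hc K hKm))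
    apply hinj
    ext j
    have h1 := hv j.1 j.2
    simp only [Matrix.vecMul, dotProduct, Matrix.of_apply] at h1
    simp only [Matrix.vecMul, dotProduct, Matrix.map_apply, Pi.zero_apply, zero_mul,
      Finset.sum_const_zero]
    rw [← h1]
    refine Finset.sum_congr rfl fun i _ => ?_
    by_cases h : j.1 ∈ A i <;> simp [P, h]

/-- A configuration of `n` vectors in `ℂᵏ` whose linear relations supported on one of the sets
`A i`, of size `k + 1`, are multiples of the `i`-th row of a matrix with independent rows. -/
theorem exists_configuration_of_hall {ι : Type*} [Fintype ι] {n k : ℕ} (A : ι → Finset (Fin n))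
    (hn : Fintype.card ι + k = n)
    (hA : ∀ J : Finset ι, J.Nonempty → J.card + k ≤ (J.biUnion A).card) :
    ∃ (M : Matrix ι (Fin n) ℂ) (c : Fin n → Fin k → ℂ),
      (∀ v : ι → ℂ, v ᵥ* M = 0 → v = 0) ∧
      ∀ i, (A i).card = k + 1 → ∀ w : Fin n → ℂ, (∀ j ∉ A i, w j = 0) →
        (∑ j, w j • c j = 0) → ∃ μ : ℂ, w = μ • M i := by
  classical
  obtain ⟨M, hsupp, hM⟩ := exists_matrix_of_hall A hA
  have hindep : ∀ v : ι → ℂ, v ᵥ* M = 0 → v = 0 := by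
    intro v hv
    obtain ⟨K, -, hK⟩ := Finset.exists_subset_card_eq
      (show k ≤ (Finset.univ : Finset (Fin n)).card by simp; omega)
    exact hM K hK v fun j _ => by rw [hv]; rfl
  have hinj : Function.Injective M.vecMul := by
    intro v w hvw
    exact sub_eq_zero.1 (hindep _ (by rw [Matrix.sub_vecMul]; exact sub_eq_zero.2 hvw))
  have hker : Module.finrank ℂ (LinearMap.ker M.mulVecLin) = k := by
    have h1 := LinearMap.finrank_range_add_finrank_ker M.mulVecLin
    have h2 : LinearMap.range M.mulVecLin = ⊤ :=
      LinearMap.range_eq_top.2 ((mulVec_surjective_iff_vecMul_injective M).2 hinj)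
    rw [h2, finrank_top, Module.finrank_fintype_fun_eq_card, Module.finrank_fintype_fun_eq_card,
      Fintype.card_fin] at h1
    omega
  -- Gale duality: with a basis of ker M as coordinates, the relations among the vectors `c j` are
  -- exactly the row space of M.
  let b := Module.finBasisOfFinrankEq ℂ (LinearMap.ker M.mulVecLin) hker
  refine ⟨M, fun j l => (b l).1 j, hindep, ?_⟩
  intro i hi w hw hrel
  have horth : ∀ x ∈ LinearMap.ker M.mulVecLin, w ⬝ᵥ x = 0 := by
    intro x hx
    have hb : ∀ l, w ⬝ᵥ (b l).1 = 0 := by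
      intro l
      have := congrFun hrel l
      simpa [dotProduct] using this
    have hx' : x = ∑ l, b.repr ⟨x, hx⟩ l • (b l).1 := by
      have := congrArg (Submodule.subtype _) (b.sum_repr ⟨x, hx⟩)
      rw [map_sum] at this
      exact this.symm
    rw [hx', dotProduct_sum]
    exact Finset.sum_eq_zero fun l _ => by rw [dotProduct_smul, hb, smul_zero]
  have hspan : ∃ v : ι → ℂ, v ᵥ* M = w := by
    have h1 : (⨅ i, LinearMap.ker (dotProductBilin ℂ ℂ (M i))) ≤
        LinearMap.ker (dotProductBilin ℂ ℂ w) := by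
      intro x hx
      rw [Submodule.mem_iInf] at hx
      apply horth
      ext i
      exact hx i
    have h2 := mem_span_of_iInf_ker_le_ker h1
    obtain ⟨v, hv⟩ := (Submodule.mem_span_range_iff_exists_fun ℂ).1 h2
    refine ⟨v, ?_⟩
    ext j
    have := LinearMap.congr_fun hv (Pi.single j 1)
    simpa [Matrix.vecMul, dotProduct, Pi.single_apply] using this
  obtain ⟨v, hv⟩ := hspan
  -- Outside K, the set A i has a single point j0. Subtracting the multiple of row i that matches w
  -- at j0 leaves a row combination vanishing off K, hence zero.
  obtain ⟨K, hKA, hK⟩ := Finset.exists_subset_card_eq (show k ≤ (A i).card by omega)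
  have hone : ∃ j0, A i \ K = {j0} := by
    rw [← Finset.card_eq_one, Finset.card_sdiff_of_subset hKA]; omega
  obtain ⟨j0, hj0⟩ := hone
  have hmem : ∀ j, j ∉ K → j ∈ A i → j = j0 := by
    intro j h1 h2
    have : j ∈ A i \ K := Finset.mem_sdiff.2 ⟨h2, h1⟩
    rw [hj0] at this
    simpa using this
  have hMne : M i j0 ≠ 0 := by
    intro h0
    have : Pi.single i (1 : ℂ) = (0 : ι → ℂ) := by
      apply hM K hK
      intro j hj
      rw [Matrix.single_one_vecMul]
      by_cases hjA : j ∈ A i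
      · rw [hmem j hj hjA]; exact h0
      · exact hsupp i j hjA
    simpa using congrFun this i
  have hv' : v - (w j0 / M i j0) • Pi.single i (1 : ℂ) = 0 := by
    apply hM K hK
    intro j hj
    rw [Matrix.sub_vecMul, Matrix.smul_vecMul, Matrix.single_one_vecMul, hv]
    simp only [Pi.sub_apply, Pi.smul_apply, smul_eq_mul, Matrix.row]
    by_cases hjA : j ∈ A i
    · rw [hmem j hj hjA]; field_simp; simp
    · rw [hw j hjA, hsupp i j hjA]; simp
  refine ⟨w j0 / M i j0, ?_⟩
  calc w = v ᵥ* M := hv.symm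
    _ = _ := by rw [sub_eq_zero.1 hv', Matrix.smul_vecMul, Matrix.single_one_vecMul]; rfl

/-! ### Independence, rank and the Hall condition. -/

variable {n k : ℕ}

/-- Every hyperplane `D_L`, `L ∈ T`, is irredundant in the intersection over `T`. -/
def IsIndep (a : Fin n → Fin k → ℂ) (T : Finset (Finset (Fin n))) : Prop :=
  ∀ L ∈ T, ∃ t : Fin n → ℂ, (∀ L' ∈ T, L' ≠ L → t ∈ discriminantalHyperplane a L') ∧
    t ∉ discriminantalHyperplane a L

/-- Any `m ≥ 1` members of `T` cover at least `m + k` points. -/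
def IsHall (k : ℕ) (T : Finset (Finset (Fin n))) : Prop :=
  ∀ J ⊆ T, J.Nonempty → J.card + k ≤ (J.biUnion id).card

theorem mem_discriminantalHyperplane (a : Fin n → Fin k → ℂ) (L : Finset (Fin n))
    (t : Fin n → ℂ) :
    t ∈ discriminantalHyperplane a L ↔ ∃ x : Fin k → ℂ, ∀ i ∈ L, a i ⬝ᵥ x = t i := by
  change (⋂ i ∈ L, hyperplane a i (t i)).Nonempty ↔ _
  simp [Set.Nonempty, hyperplane]

theorem mem_iInf_hyperplane (a : Fin n → Fin k → ℂ) (T : Finset (Finset (Fin n)))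
    (t : Fin n → ℂ) :
    t ∈ (⨅ L ∈ T, discriminantalHyperplane a L) ↔
      ∀ L ∈ T, t ∈ discriminantalHyperplane a L := by
  simp [Submodule.mem_iInf]

theorem rank_add_finrank (X : Submodule ℂ (Fin n → ℂ)) : rank X + Module.finrank ℂ X = n := by
  simpa [rank] using X.finrank_quotient_add_finrank

theorem rank_le_of_le {X Y : Submodule ℂ (Fin n → ℂ)} (h : X ≤ Y) : rank Y ≤ rank X := by
  have h1 := rank_add_finrank X
  have h2 := rank_add_finrank Y
  have h3 := Submodule.finrank_mono h
  omega

theorem eq_of_le_of_rank_le {X Y : Submodule ℂ (Fin n → ℂ)} (h : X ≤ Y) (hr : rank X ≤ rank Y) :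
    X = Y := by
  have h1 := rank_add_finrank X
  have h2 := rank_add_finrank Y
  exact Submodule.eq_of_le_of_finrank_le h (by omega)

theorem IsIndep.subset {a : Fin n → Fin k → ℂ} {T J : Finset (Finset (Fin n))}
    (hT : IsIndep a T) (hJ : J ⊆ T) : IsIndep a J := by
  intro L hL
  obtain ⟨t, h1, h2⟩ := hT L (hJ hL)
  exact ⟨t, fun L' hL' => h1 L' (hJ hL'), h2⟩

/-- The witnesses of irredundancy are linearly independent modulo the intersection: the witness for
L is the only one outside D_L. -/
theorem IsIndep.card_le_rank {a : Fin n → Fin k → ℂ} {T : Finset (Finset (Fin n))}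
    (hT : IsIndep a T) : T.card ≤ rank (⨅ L ∈ T, discriminantalHyperplane a L) := by
  classical
  choose! t ht hnt using hT
  set X := ⨅ L ∈ T, discriminantalHyperplane a L with hX
  have hli : LinearIndependent ℂ (fun L : T => X.mkQ (t L)) := by
    rw [Fintype.linearIndependent_iff]
    intro g hg L
    have h1 : (∑ L' : T, g L' • t L') ∈ X := by
      rw [← Submodule.Quotient.mk_eq_zero, ← Submodule.mkQ_apply, map_sum]
      simpa using hg
    have h2 := (mem_iInf_hyperplane a T _).1 h1 L.1 L.2
    rw [← Finset.add_sum_erase _ _ (Finset.mem_univ L)] at h2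
    have h3 : (∑ L' ∈ Finset.univ.erase L, g L' • t L') ∈ discriminantalHyperplane a L.1 := by
      refine Submodule.sum_mem _ fun L' hL' => Submodule.smul_mem _ _ ?_
      refine ht L'.1 L'.2 L.1 L.2 fun h => ?_
      exact (Finset.ne_of_mem_erase hL') (Subtype.ext h.symm)
    have h4 := (Submodule.add_mem_iff_left _ h3).1 h2
    by_contra hne
    exact hnt L.1 L.2 ((Submodule.smul_mem_iff _ hne).1 h4)
  simpa [rank] using hli.fintype_card_le_finrank

/-- In a central generic arrangement any `k` of the normal vectors separate points. -/
theorem IsCentralGeneric.eq_zero {a : Fin n → Fin k → ℂ} (ha : IsCentralGeneric a)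
    {K : Finset (Fin n)} (hK : k ≤ K.card) {x : Fin k → ℂ} (hx : ∀ i ∈ K, a i ⬝ᵥ x = 0) :
    x = 0 := by
  obtain ⟨K', hK', hc⟩ := Finset.exists_subset_card_eq hK
  have h1 := ha K' hc.le
  have h2 : Module.finrank ℂ ↥(⨅ i ∈ K', centralHyperplane a i) = 0 := by omega
  have h3 := Submodule.finrank_eq_zero.1 h2
  have h4 : x ∈ ⨅ i ∈ K', centralHyperplane a i := by
    simp only [Submodule.mem_iInf]
    exact fun i hi => hx i (hK' hi)
  rw [h3] at h4
  exact (Submodule.mem_bot ℂ).1 h4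

theorem discriminantalHyperplane_ne_top (a : Fin n → Fin k → ℂ) {L : Finset (Fin n)}
    (hL : L.card = k + 1) :
    ∃ t, t ∉ discriminantalHyperplane a L := by
  by_contra! hcon
  let f : (Fin k → ℂ) →ₗ[ℂ] (L → ℂ) := (Matrix.of fun (i : L) j => a i j).mulVecLin
  have hf : Function.Surjective f := by
    intro w
    classical
    obtain ⟨x, hx⟩ := (mem_discriminantalHyperplane a L _).1
      (hcon fun i => if h : i ∈ L then w ⟨i, h⟩ else 0)
    refine ⟨x, ?_⟩
    ext i
    have h : a i ⬝ᵥ x = w i := by simpa using hx i.1 i.2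
    exact h
  have := LinearMap.finrank_le_finrank_of_surjective hf
  simp [hL] at this

/-- For i in L' but not in L, the unit vector at i lies in D_L (take x = 0). It is not in D_{L'},
since the other k equations force x = 0. -/
theorem IsCentralGeneric.hyperplane_le {a : Fin n → Fin k → ℂ} (ha : IsCentralGeneric a)
    {L L' : Finset (Fin n)} (hL : L.card = k + 1) (hL' : L'.card = k + 1)
    (h : discriminantalHyperplane a L ≤ discriminantalHyperplane a L') : L = L' := by
  classical
  symm
  refine Finset.eq_of_subset_of_card_le (fun i hi => ?_) (by omega)
  by_contra hiL
  have h1 : Pi.single i 1 ∈ discriminantalHyperplane a L := by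
    rw [mem_discriminantalHyperplane]
    refine ⟨0, fun j hj => ?_⟩
    have : j ≠ i := fun h => hiL (h ▸ hj)
    simp [this]
  obtain ⟨x, hx⟩ := (mem_discriminantalHyperplane a L' _).1 (h h1)
  have h2 : x = 0 := by
    refine ha.eq_zero (K := L'.erase i) (by rw [Finset.card_erase_of_mem hi]; omega) ?_
    intro j hj
    rw [hx j (Finset.mem_of_mem_erase hj), Pi.single_eq_of_ne (Finset.ne_of_mem_erase hj)]
  have h3 := hx i hi
  rw [h2] at h3
  simp at h3

theorem IsCentralGeneric.rank_flat_le {a : Fin n → Fin k → ℂ} (ha : IsCentralGeneric a)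
    {S : Finset (Fin n)} (hS : k ≤ S.card) : rank (discriminantalFlat a S) + k ≤ S.card := by
  classical
  -- A common point x and free coordinates off S parametrize a subspace of D_S of dimension k + n -
  -- |S|.
  let f : (Fin k → ℂ) × ({i // i ∉ S} → ℂ) →ₗ[ℂ] (Fin n → ℂ) :=
    { toFun := fun p i => if h : i ∈ S then a i ⬝ᵥ p.1 else p.2 ⟨i, h⟩
      map_add' := by
        intro p q
        ext i
        by_cases h : i ∈ S <;> simp [h, dotProduct_add]
      map_smul' := by
        intro c p
        ext i
        by_cases h : i ∈ S <;> simp [h, dotProduct_smul] }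
  have hf : Function.Injective f := by
    rw [← LinearMap.ker_eq_bot, LinearMap.ker_eq_bot']
    rintro ⟨x, u⟩ h
    have h1 : x = 0 := by
      refine ha.eq_zero hS fun i hi => ?_
      have := congrFun h i
      simpa [f, hi] using this
    have h2 : u = 0 := by
      ext i
      have := congrFun h i.1
      simpa [f, i.2] using this
    rw [h1, h2]; rfl
  have hle : LinearMap.range f ≤ discriminantalFlat a S := by
    rintro _ ⟨p, rfl⟩
    refine (mem_iInf_hyperplane a _ _).2 fun L hL => ?_
    rw [mem_discriminantalHyperplane]
    refine ⟨p.1, fun i hi => ?_⟩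
    have : i ∈ S := (Finset.mem_powersetCard.1 hL).1 hi
    simp [f, this]
  have h1 := Submodule.finrank_mono hle
  rw [LinearMap.finrank_range_of_inj hf] at h1
  have h2 := rank_add_finrank (discriminantalFlat a S)
  have h3 : Fintype.card {i // i ∉ S} = n - S.card := by
    rw [Fintype.card_subtype_compl]; simp
  have h4 : S.card ≤ n := by simpa using Finset.card_le_univ S
  simp only [Module.finrank_prod, Module.finrank_fintype_fun_eq_card, Fintype.card_fin, h3] at h1
  omega

theorem flat_biUnion_le (a : Fin n → Fin k → ℂ) {J : Finset (Finset (Fin n))}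
    (hJ : ∀ L ∈ J, L.card = k + 1) :
    discriminantalFlat a (J.biUnion id) ≤ ⨅ L ∈ J, discriminantalHyperplane a L := by
  intro t ht
  refine (mem_iInf_hyperplane a _ _).2 fun L hL => ?_
  refine (mem_iInf_hyperplane a _ _).1 ht L (Finset.mem_powersetCard.2 ⟨?_, hJ L hL⟩)
  exact Finset.subset_biUnion_of_mem id hL

theorem IsCentralGeneric.isHall_of_isIndep {a : Fin n → Fin k → ℂ} (ha : IsCentralGeneric a)
    {T : Finset (Finset (Fin n))} (hc : ∀ L ∈ T, L.card = k + 1) (hT : IsIndep a T) :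
    IsHall k T := by
  intro J hJ ⟨L, hL⟩
  have hcJ : ∀ L ∈ J, L.card = k + 1 := fun L hL => hc L (hJ hL)
  have h1 := (hT.subset hJ).card_le_rank
  have h2 := rank_le_of_le (flat_biUnion_le a hcJ)
  have h3 : L.card ≤ (J.biUnion id).card :=
    Finset.card_le_card (Finset.subset_biUnion_of_mem id hL)
  have h4 := hcJ L hL
  have h5 := ha.rank_flat_le (S := J.biUnion id) (by omega)
  omega

/-- A set of hyperplanes violating the Hall condition contains some of two or more members whose
intersection is a `D_S`, provided the Hall condition suffices for independence. -/
theorem IsCentralGeneric.exists_inter_eq_flat {a : Fin n → Fin k → ℂ} (ha : IsCentralGeneric a)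
    (hind : ∀ T : Finset (Finset (Fin n)), (∀ L ∈ T, L.card = k + 1) → IsHall k T → IsIndep a T)
    {T : Finset (Finset (Fin n))} (hc : ∀ L ∈ T, L.card = k + 1) (hT : ¬ IsHall k T) :
    ∃ J ⊆ T, 2 ≤ J.card ∧ ∃ S : Finset (Fin n), k + 1 < S.card ∧
      ⨅ L ∈ J, discriminantalHyperplane a L = discriminantalFlat a S := by
  classical
  -- The violating subfamily is taken of least cardinality, so removing any member restores the Hall
  -- condition.
  have hex : ∃ m, ∃ J ⊆ T, J.Nonempty ∧ (J.biUnion id).card < J.card + k ∧ J.card = m := by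
    unfold IsHall at hT
    push Not at hT
    obtain ⟨J, h1, h2, h3⟩ := hT
    exact ⟨_, J, h1, h2, h3, rfl⟩
  obtain ⟨J, hJT, hJ, hlt, hm⟩ := Nat.find_spec hex
  have hmin : ∀ J' ⊆ T, J'.Nonempty → J'.card < J.card → J'.card + k ≤ (J'.biUnion id).card := by
    intro J' h1 h2 h3
    by_contra! h4
    exact Nat.find_min hex (hm ▸ h3) ⟨J', h1, h2, h4, rfl⟩
  have hcJ : ∀ L ∈ J, L.card = k + 1 := fun L hL => hc L (hJT hL)
  obtain ⟨L, hL⟩ := hJ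
  have hLs : L ⊆ J.biUnion id := Finset.subset_biUnion_of_mem id hL
  have hLc := Finset.card_le_card hLs
  have hLk := hcJ L hL
  have h2 : 2 ≤ J.card := by omega
  obtain ⟨L', hL', hne⟩ := Finset.exists_mem_ne (show 1 < J.card by omega) L
  have hS : k + 1 < (J.biUnion id).card := by
    by_contra! hle
    have e1 := Finset.eq_of_subset_of_card_le hLs (by omega)
    have e2 := Finset.eq_of_subset_of_card_le (Finset.subset_biUnion_of_mem id hL')
      (by have := hcJ L' hL'; simp only [id]; omega)
    exact hne (e2.trans e1.symm)
  refine ⟨J, hJT, h2, J.biUnion id, hS, ?_⟩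
  symm
  -- The ranks satisfy rank D_S ≤ |S| - k ≤ |J| - 1 ≤ rank of the intersection over J.
  refine eq_of_le_of_rank_le (flat_biUnion_le a hcJ) ?_
  have hHall : IsHall k (J.erase L) := by
    intro J' hJ' hne'
    refine hmin J' (hJ'.trans ((Finset.erase_subset _ _).trans hJT)) hne' ?_
    have := Finset.card_le_card hJ'
    rw [Finset.card_erase_of_mem hL] at this
    omega
  have h3 := (hind _ (fun L' h => hcJ L' (Finset.mem_of_mem_erase h)) hHall).card_le_rank
  have h4 : (⨅ L' ∈ J, discriminantalHyperplane a L') ≤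
      ⨅ L' ∈ J.erase L, discriminantalHyperplane a L' :=
    biInf_mono fun L' h => Finset.mem_of_mem_erase h
  have h5 := rank_le_of_le h4
  have h6 := ha.rank_flat_le (S := J.biUnion id) (by omega)
  rw [Finset.card_erase_of_mem hL] at h3
  omega

/-! ### Invariance of independence under lattice isomorphisms. -/

/-- An isomorphism of intersection lattices permutes the hyperplanes. -/
theorem exists_image_hyperplane {a b : Fin n → Fin k → ℂ} (ha : IsCentralGeneric a)
    (e : ↥(intersectionLattice a) ≃o ↥(intersectionLattice b))
    {L : Finset (Fin n)} (hL : L.card = k + 1) :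
    ∃ L' : Finset (Fin n), L'.card = k + 1 ∧
      ∀ X : ↥(intersectionLattice a), X.1 = discriminantalHyperplane a L →
        (e X).1 = discriminantalHyperplane b L' := by
  have hmem : ∀ (c : Fin n → Fin k → ℂ) {L : Finset (Fin n)}, L.card = k + 1 →
      discriminantalHyperplane c L ∈ intersectionLattice c :=
    fun c L h => ⟨{L}, by simpa using h, by simp⟩
  have htop : (⊤ : Submodule ℂ (Fin n → ℂ)) ∈ intersectionLattice a := ⟨∅, by simp, by simp⟩
  let D : ↥(intersectionLattice a) := ⟨_, hmem a hL⟩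
  obtain ⟨t, ht⟩ := discriminantalHyperplane_ne_top a hL
  have hDtop : D.1 ≠ ⊤ := fun h => ht (by change t ∈ D.1; rw [h]; trivial)
  obtain ⟨T, hTc, hT⟩ := (e D).2
  have hTne : T.Nonempty := by
    rw [Finset.nonempty_iff_ne_empty]
    rintro rfl
    have h1 : e ⟨⊤, htop⟩ ≤ e D := by
      change (e ⟨⊤, htop⟩).1 ≤ (e D).1
      rw [hT]; simp
    exact hDtop (top_le_iff.1 (e.le_iff_le.1 h1))
  obtain ⟨L', hL'⟩ := hTne
  let D' : ↥(intersectionLattice b) := ⟨_, hmem b (hTc L' hL')⟩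
  -- Pulling D' back traps it between D_L and some D_{L''}; these coincide, so e D = D'.
  have hle : e D ≤ D' := by
    change (e D).1 ≤ discriminantalHyperplane b L'
    rw [hT]
    exact biInf_le _ hL'
  have hle' : D ≤ e.symm D' := by rwa [e.le_symm_apply]
  obtain ⟨T', hTc', hT'⟩ := (e.symm D').2
  have hTne' : T'.Nonempty := by
    rw [Finset.nonempty_iff_ne_empty]
    rintro rfl
    have htb : (⊤ : Submodule ℂ (Fin n → ℂ)) ∈ intersectionLattice b := ⟨∅, by simp, by simp⟩
    have h1 : e.symm ⟨⊤, htb⟩ ≤ e.symm D' := by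
      change (e.symm ⟨⊤, htb⟩).1 ≤ (e.symm D').1
      rw [hT']; simp
    have h2 := e.symm.le_iff_le.1 h1
    obtain ⟨u, hu⟩ := discriminantalHyperplane_ne_top b (hTc L' hL')
    exact hu (h2 (show u ∈ (⊤ : Submodule ℂ (Fin n → ℂ)) from trivial))
  obtain ⟨L'', hL''⟩ := hTne'
  have hle'' : (e.symm D').1 ≤ discriminantalHyperplane a L'' := by
    rw [hT']
    exact biInf_le _ hL''
  have heq : L = L'' := ha.hyperplane_le hL (hTc' L'' hL'') (le_trans hle' hle'')
  subst heq
  have h1 : e.symm D' = D := le_antisymm hle'' hle'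
  have h2 : e D = D' := by rw [← h1]; simp
  refine ⟨L', hTc L' hL', fun X hX => ?_⟩
  have : X = D := Subtype.ext hX
  rw [this, h2]

/-- Independence is a lattice property: D_L is irredundant when the intersection of the other
members is not below it. The permutation σ of hyperplanes therefore maps independent families to
independent families. -/
theorem card_isIndep_le {a b : Fin n → Fin k → ℂ} (ha : IsCentralGeneric a)
    (e : ↥(intersectionLattice a) ≃o ↥(intersectionLattice b)) :
    {T : Finset (Finset (Fin n)) | (∀ L ∈ T, L.card = k + 1) ∧ IsIndep a T}.ncard ≤
      {T : Finset (Finset (Fin n)) | (∀ L ∈ T, L.card = k + 1) ∧ IsIndep b T}.ncard := by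
  classical
  have hmem : ∀ {L : Finset (Fin n)}, L.card = k + 1 →
      discriminantalHyperplane a L ∈ intersectionLattice a :=
    fun {L} h => ⟨{L}, by simpa using h, by simp⟩
  have hσ : ∀ L : Finset (Fin n), L.card = k + 1 → ∃ L' : Finset (Fin n), L'.card = k + 1 ∧
      ∀ X : ↥(intersectionLattice a), X.1 = discriminantalHyperplane a L →
        (e X).1 = discriminantalHyperplane b L' :=
    fun L hL => exists_image_hyperplane ha e hL
  choose! σ hσc hσ using hσ
  have hinj : ∀ L L' : Finset (Fin n), L.card = k + 1 → L'.card = k + 1 → σ L = σ L' →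
      L = L' := by
    intro L L' hL hL' h
    have h1 : e ⟨_, hmem hL⟩ = e ⟨_, hmem hL'⟩ := by
      apply Subtype.ext
      rw [hσ L hL _ rfl, hσ L' hL' _ rfl, h]
    have h2 := congrArg Subtype.val (e.injective h1)
    exact ha.hyperplane_le hL hL' h2.le
  refine Set.ncard_le_ncard_of_injOn (fun T => T.image σ) ?_ ?_ (Set.toFinite _)
  · rintro T ⟨hc, hT⟩
    refine ⟨?_, ?_⟩
    · intro L hL
      obtain ⟨L₀, h, rfl⟩ := Finset.mem_image.1 hL
      exact hσc _ (hc _ h)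
    · intro L hL
      obtain ⟨L₀, hL₀, rfl⟩ := Finset.mem_image.1 hL
      obtain ⟨t, ht, hnt⟩ := hT L₀ hL₀
      let Y : ↥(intersectionLattice a) :=
        ⟨⨅ L ∈ T.erase L₀, discriminantalHyperplane a L, T.erase L₀,
          fun L h => hc L (Finset.mem_of_mem_erase h), rfl⟩
      have htY : t ∈ Y.1 := (mem_iInf_hyperplane a _ _).2 fun L h =>
        ht L (Finset.mem_of_mem_erase h) (Finset.ne_of_mem_erase h)
      have hY : ¬ e Y ≤ e ⟨_, hmem (hc _ hL₀)⟩ := by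
        rw [e.le_iff_le]
        exact fun h => hnt (h htY)
      have hY' : ¬ (e Y).1 ≤ discriminantalHyperplane b (σ L₀) := by
        rw [← hσ L₀ (hc _ hL₀) ⟨_, hmem (hc _ hL₀)⟩ rfl]
        exact hY
      obtain ⟨u, hu, hnu⟩ := SetLike.not_le_iff_exists.1 hY'
      refine ⟨u, ?_, hnu⟩
      intro L' hL' hne
      obtain ⟨L₁, hL₁, rfl⟩ := Finset.mem_image.1 hL'
      have hne' : L₁ ≠ L₀ := fun h => hne (h ▸ rfl)
      have h0 : Y.1 ≤ discriminantalHyperplane a L₁ :=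
        biInf_le (discriminantalHyperplane a) (Finset.mem_erase.2 ⟨hne', hL₁⟩)
      have h1 : e Y ≤ e ⟨_, hmem (hc _ hL₁)⟩ := e.le_iff_le.2 h0
      rw [← hσ L₁ (hc _ hL₁) ⟨_, hmem (hc _ hL₁)⟩ rfl]
      exact h1 hu
  · have key : ∀ T T' : Finset (Finset (Fin n)), (∀ L ∈ T, L.card = k + 1) →
        (∀ L ∈ T', L.card = k + 1) → T.image σ = T'.image σ → T ⊆ T' := by
      intro T T' hT hT' h L hL
      have h1 : σ L ∈ T'.image σ := h ▸ Finset.mem_image_of_mem σ hL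
      obtain ⟨L', hL', h2⟩ := Finset.mem_image.1 h1
      exact hinj L' L (hT' L' hL') (hT L hL) h2 ▸ hL'
    rintro T ⟨hc, -⟩ T' ⟨hc', -⟩ h
    exact (key T T' hc hc' h).antisymm (key T' T hc' hc h.symm)

/-! ### Hall families are independent for some configuration. -/

/-- The matrix, with entries polynomial in the configuration `c`, of the linear map
`(t, x, y) ↦ tᵢ + ⟨cᵢ, x_L⟩ + [i ∉ L] y_{L,i}` with rows indexed by pairs `(L, i)`, `L ∈ T`. -/
noncomputable def incidenceMatrix (k : ℕ) (T : Finset (Finset (Fin n))) :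
    Matrix (T × Fin n) (Fin n ⊕ (T × Fin k) ⊕ (T × Fin n)) (MvPolynomial (Fin n × Fin k) ℂ) :=
  Matrix.of fun p => Sum.elim (fun j => if p.2 = j then 1 else 0)
    (Sum.elim (fun q => if p.1 = q.1 then MvPolynomial.X (p.2, q.2) else 0)
      (fun q => if p = q ∧ q.2 ∉ q.1.1 then 1 else 0))

/-- The matrix of the normal vectors indexed by `K`, with indeterminate entries. -/
noncomputable def normalMatrix (k : ℕ) (K : Finset (Fin n)) :
    Matrix K (Fin k) (MvPolynomial (Fin n × Fin k) ℂ) :=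
  Matrix.of fun i j => MvPolynomial.X (i.1, j)

theorem incidenceMatrix_mulVec (T : Finset (Finset (Fin n))) (c : Fin n → Fin k → ℂ)
    (v : Fin n ⊕ (T × Fin k) ⊕ (T × Fin n) → ℂ) (L : T) (i : Fin n) :
    (((incidenceMatrix k T).map (MvPolynomial.eval fun ij => c ij.1 ij.2)) *ᵥ v) (L, i) =
      v (Sum.inl i) + (c i ⬝ᵥ (fun j => v (Sum.inr (Sum.inl (L, j)))) +
        if i ∉ L.1 then v (Sum.inr (Sum.inr (L, i))) else 0) := by
  simp only [incidenceMatrix, Matrix.mulVec, dotProduct, Matrix.map_apply, Matrix.of_apply,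
    Fintype.sum_sum_type, Sum.elim_inl, Sum.elim_inr]
  congr 1
  · rw [Finset.sum_eq_single i] <;> simp +contextual [eq_comm]
  congr 1
  · rw [Fintype.sum_prod_type, Finset.sum_eq_single L]
    · simp
    · intro L' _ h
      simp [h.symm]
    · simp
  · rw [Finset.sum_eq_single (L, i)]
    · by_cases h : i ∈ L.1 <;> simp [h]
    · intro q _ h
      simp [h.symm]
    · simp

/-- The block y absorbs coordinates outside L, and x_L absorbs translations. Reaching the target
that is some t ∉ D_L in block L and 0 in the others gives the witness for L. -/
theorem isIndep_of_surjective {T : Finset (Finset (Fin n))} (hc : ∀ L ∈ T, L.card = k + 1)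
    (c : Fin n → Fin k → ℂ) (h : Function.Surjective
      ((incidenceMatrix k T).map (MvPolynomial.eval fun ij => c ij.1 ij.2)).mulVec) :
    IsIndep c T := by
  classical
  intro L hL
  obtain ⟨t, ht⟩ := discriminantalHyperplane_ne_top c (hc L hL)
  obtain ⟨v, hv⟩ := h fun p => if p.1.1 = L then t p.2 else 0
  have hv' : ∀ (L' : T) (i : Fin n), i ∈ L'.1 → v (Sum.inl i) +
      c i ⬝ᵥ (fun j => v (Sum.inr (Sum.inl (L', j)))) = if L'.1 = L then t i else 0 := by
    intro L' i hi
    have h1 := congrFun hv (L', i)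
    rw [incidenceMatrix_mulVec] at h1
    simpa [hi] using h1
  refine ⟨fun i => v (Sum.inl i), ?_, ?_⟩
  · intro L' hL' hne
    rw [mem_discriminantalHyperplane]
    refine ⟨-fun j => v (Sum.inr (Sum.inl (⟨L', hL'⟩, j))), fun i hi => ?_⟩
    have h1 := hv' ⟨L', hL'⟩ i hi
    rw [if_neg hne] at h1
    rw [dotProduct_neg]
    linear_combination -h1
  · intro hmem
    obtain ⟨x, hx⟩ := (mem_discriminantalHyperplane c L _).1 hmem
    apply ht
    rw [mem_discriminantalHyperplane]
    refine ⟨x + fun j => v (Sum.inr (Sum.inl (⟨L, hL⟩, j))), fun i hi => ?_⟩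
    have h1 := hv' ⟨L, hL⟩ i hi
    rw [if_pos rfl] at h1
    rw [dotProduct_add, hx i hi, h1]

/-- A vector w in the left kernel consists of relations among the `c i`, one supported on each L,
summing to zero. Each is a multiple of a row of M, and the rows are independent, so w = 0. -/
theorem IsHall.exists_surjective (hkn : k < n) {T : Finset (Finset (Fin n))}
    (hc : ∀ L ∈ T, L.card = k + 1) (hT : IsHall k T) :
    ∃ c : Fin n × Fin k → ℂ, Function.Surjective
      ((incidenceMatrix k T).map (MvPolynomial.eval c)).mulVec := by
  classical
  have hcard : T.card + k ≤ n := by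
    rcases T.eq_empty_or_nonempty with rfl | hne
    · simpa using hkn.le
    · have h1 := hT T subset_rfl hne
      have h2 := Finset.card_le_univ (T.biUnion id)
      rw [Fintype.card_fin] at h2
      omega
  -- Padding by copies of the full set brings the number of rows to n - k, as Gale duality in ℂᵏ
  -- requires.
  let A : T ⊕ Fin (n - k - T.card) → Finset (Fin n) := Sum.elim (fun L => L.1) fun _ => Finset.univ
  have hιn : Fintype.card (T ⊕ Fin (n - k - T.card)) + k = n := by
    simp; omega
  have hA : ∀ J : Finset (T ⊕ Fin (n - k - T.card)), J.Nonempty →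
      J.card + k ≤ (J.biUnion A).card := by
    intro J hJ
    by_cases hr : ∃ m, Sum.inr m ∈ J
    · obtain ⟨m, hm⟩ := hr
      have h1 : (Finset.univ : Finset (Fin n)) ⊆ J.biUnion A :=
        Finset.subset_biUnion_of_mem A hm
      have h2 := Finset.card_le_card h1
      have h3 := Finset.card_le_univ J
      rw [Finset.card_univ, Fintype.card_fin] at h2
      omega
    · push Not at hr
      have h1 : J.card = (J.image A).card := by
        rw [Finset.card_image_of_injOn]
        rintro (L | m) hx (L' | m') hy h
        · exact congrArg _ (Subtype.ext h)
        · exact absurd hy (hr _)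
        · exact absurd hx (hr _)
        · exact absurd hx (hr _)
      have h2 : (J.image A).biUnion id = J.biUnion A := by
        rw [Finset.image_biUnion]; rfl
      rw [h1, ← h2]
      refine hT _ ?_ (hJ.image A)
      intro L hL
      obtain ⟨x, hx, rfl⟩ := Finset.mem_image.1 hL
      rcases x with L | m
      · exact L.2
      · exact absurd hx (hr _)
  obtain ⟨M, c, hM, hrel⟩ := exists_configuration_of_hall A hιn hA
  refine ⟨fun ij => c ij.1 ij.2, ?_⟩
  rw [mulVec_surjective_iff_vecMul_injective, ← Matrix.coe_vecMulLinear]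
  rw [← LinearMap.ker_eq_bot, LinearMap.ker_eq_bot']
  intro w hw
  have hw' := fun q => congrFun hw q
  simp only [Matrix.vecMulLinear_apply, Matrix.vecMul, dotProduct,
    incidenceMatrix, Matrix.map_apply, Matrix.of_apply, Pi.zero_apply] at hw'
  have h1 : ∀ i, ∑ L : T, w (L, i) = 0 := by
    intro i
    have := hw' (Sum.inl i)
    rw [Fintype.sum_prod_type] at this
    simpa [apply_ite] using this
  have h2 : ∀ L : T, ∑ i, w (L, i) • c i = 0 := by
    intro L
    ext j
    have := hw' (Sum.inr (Sum.inl (L, j)))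
    rw [Fintype.sum_prod_type, Finset.sum_eq_single L] at this
    · simpa using this
    · intro L' _ h
      simp [h]
    · simp
  have h3 : ∀ L : T, ∀ i ∉ L.1, w (L, i) = 0 := by
    intro L i hi
    have := hw' (Sum.inr (Sum.inr (L, i)))
    rw [Finset.sum_eq_single (L, i)] at this
    · simpa [hi] using this
    · intro q _ h
      simp [h]
    · simp
  have h4 : ∀ L : T, ∃ μ : ℂ, (fun i => w (L, i)) = μ • M (Sum.inl L) :=
    fun L => hrel (Sum.inl L) (hc L.1 L.2) _ (h3 L) (h2 L)
  choose μ hμ using h4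
  have h5 : (Sum.elim μ 0 : T ⊕ Fin (n - k - T.card) → ℂ) = 0 := by
    apply hM
    ext i
    rw [Pi.zero_apply, ← h1 i]
    simp only [Matrix.vecMul, dotProduct, Fintype.sum_sum_type, Sum.elim_inl, Sum.elim_inr,
      Pi.zero_apply, zero_mul, Finset.sum_const_zero, add_zero]
    exact Finset.sum_congr rfl fun L _ => (congrFun (hμ L) i).symm
  ext ⟨L, i⟩
  have h6 : μ L = 0 := congrFun h5 (Sum.inl L)
  have h7 := congrFun (hμ L) i
  rw [h6] at h7
  simpa using h7

/-! ### Generic and very generic arrangements. -/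

theorem iInf_centralHyperplane (c : Fin n → Fin k → ℂ) (K : Finset (Fin n)) :
    ⨅ i ∈ K, centralHyperplane c i = LinearMap.ker ((normalMatrix k K).map
      (MvPolynomial.eval fun ij => c ij.1 ij.2)).mulVecLin := by
  ext x
  have h : ∀ i : K, (((normalMatrix k K).map
      (MvPolynomial.eval fun ij => c ij.1 ij.2)) *ᵥ x) i = c i ⬝ᵥ x := by
    intro i
    simp [normalMatrix, Matrix.mulVec, dotProduct]
  simp only [Submodule.mem_iInf, LinearMap.mem_ker, Matrix.mulVecLin_apply, funext_iff, h,
    Subtype.forall, Pi.zero_apply]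
  rfl

theorem isCentralGeneric_iff (c : Fin n → Fin k → ℂ) :
    IsCentralGeneric c ↔ ∀ K : Finset (Fin n), K.card ≤ k → Function.Surjective
      ((normalMatrix k K).map (MvPolynomial.eval fun ij => c ij.1 ij.2)).mulVec := by
  refine forall_congr' fun K => forall_congr' fun hK => ?_
  rw [iInf_centralHyperplane, ← Matrix.coe_mulVecLin, ← LinearMap.range_eq_top]
  set f := ((normalMatrix k K).map (MvPolynomial.eval fun ij => c ij.1 ij.2)).mulVecLin
  have h1 := LinearMap.finrank_range_add_finrank_ker f
  rw [Module.finrank_fintype_fun_eq_card, Fintype.card_fin] at h1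
  have h2 : Module.finrank ℂ (K → ℂ) = K.card := by simp
  constructor
  · intro h
    apply Submodule.eq_top_of_finrank_eq
    omega
  · intro h
    rw [h, finrank_top, h2] at h1
    omega

/-- Some central generic arrangement in a given nonempty Zariski open set has as many independent
sets of hyperplanes as the Hall condition permits. -/
theorem exists_generic (hkn : k < n) {a : Fin n → Fin k → ℂ} (ha : IsCentralGeneric a)
    (p : MvPolynomial (Fin n × Fin k) ℂ)
    (hp : MvPolynomial.eval (fun ij => a ij.1 ij.2) p ≠ 0) :
    ∃ b : Fin n → Fin k → ℂ, IsCentralGeneric b ∧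
      MvPolynomial.eval (fun ij => b ij.1 ij.2) p ≠ 0 ∧
      ∀ T : Finset (Finset (Fin n)), (∀ L ∈ T, L.card = k + 1) → IsHall k T → IsIndep b T := by
  have h1 : ∀ K : Finset (Fin n), ∃ q : MvPolynomial (Fin n × Fin k) ℂ, q ≠ 0 ∧
      ∀ c : Fin n × Fin k → ℂ, MvPolynomial.eval c q ≠ 0 → K.card ≤ k →
        Function.Surjective ((normalMatrix k K).map (MvPolynomial.eval c)).mulVec := by
    intro K
    by_cases hK : K.card ≤ k
    · obtain ⟨q, hq, h⟩ := exists_polynomial_of_surjective _ _ ((isCentralGeneric_iff a).1 ha K hK)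
      exact ⟨q, hq, fun c hc _ => h c hc⟩
    -- The polynomial 1 imposes no condition for irrelevant index sets.
    · exact ⟨1, one_ne_zero, fun c _ h => absurd h hK⟩
  have h2 : ∀ T : Finset (Finset (Fin n)), ∃ q : MvPolynomial (Fin n × Fin k) ℂ, q ≠ 0 ∧
      ∀ c : Fin n × Fin k → ℂ, MvPolynomial.eval c q ≠ 0 → (∀ L ∈ T, L.card = k + 1) →
        IsHall k T → Function.Surjective
          ((incidenceMatrix k T).map (MvPolynomial.eval c)).mulVec := by
    intro T
    by_cases hT : (∀ L ∈ T, L.card = k + 1) ∧ IsHall k T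
    · obtain ⟨c, hc⟩ := hT.2.exists_surjective hkn hT.1
      obtain ⟨q, hq, h⟩ := exists_polynomial_of_surjective _ _ hc
      exact ⟨q, hq, fun c hc _ _ => h c hc⟩
    · exact ⟨1, one_ne_zero, fun c _ h h' => absurd ⟨h, h'⟩ hT⟩
  choose q₁ hq₁ h1 using h1
  choose q₂ hq₂ h2 using h2
  have hp0 : p ≠ 0 := by rintro rfl; simp at hp
  obtain ⟨c, hc⟩ := exists_forall_eval_ne_zero Finset.univ
    (fun o : Option (Finset (Fin n) ⊕ Finset (Finset (Fin n))) => o.elim p (Sum.elim q₁ q₂))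
    (by rintro (_ | K | T) -; exacts [hp0, hq₁ K, hq₂ T])
  refine ⟨fun i j => c (i, j), ?_, hc none (Finset.mem_univ _), ?_⟩
  · rw [isCentralGeneric_iff]
    exact fun K hK => h1 K c (hc (some (Sum.inl K)) (Finset.mem_univ _)) hK
  · intro T hT hH
    exact isIndep_of_surjective hT _ (h2 T c (hc (some (Sum.inr T)) (Finset.mem_univ _)) hT hH)

/-- In a very generic arrangement the Hall condition characterizes independence. -/
theorem IsVeryGeneric.isIndep_of_isHall (hkn : k < n) {a : Fin n → Fin k → ℂ}
    (ha : IsCentralGeneric a) (hvg : IsVeryGeneric a) {T : Finset (Finset (Fin n))}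
    (hc : ∀ L ∈ T, L.card = k + 1) (hT : IsHall k T) : IsIndep a T := by
  obtain ⟨U, ⟨⟨P, hP⟩, hiso⟩, haU⟩ := hvg
  have haU' := haU
  rw [hP] at haU'
  obtain ⟨-, p, hpP, hp⟩ := haU'
  obtain ⟨b, hb, hpb, hind⟩ := exists_generic hkn ha p hp
  have hbU : b ∈ U := by
    rw [hP]
    exact ⟨hb, p, hpP, hpb⟩
  obtain ⟨e⟩ := hiso a haU b hbU
  have hsub : {T : Finset (Finset (Fin n)) | (∀ L ∈ T, L.card = k + 1) ∧ IsIndep a T} ⊆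
      {T : Finset (Finset (Fin n)) | (∀ L ∈ T, L.card = k + 1) ∧ IsIndep b T} :=
    fun T hT => ⟨hT.1, hind T hT.1 (ha.isHall_of_isIndep hT.1 hT.2)⟩
  -- Independent families of a are Hall, hence independent for b; equal counts turn this inclusion
  -- into equality.
  have heq := Set.eq_of_subset_of_ncard_le hsub (card_isIndep_le hb e.symm) (Set.toFinite _)
  have : T ∈ {T : Finset (Finset (Fin n)) | (∀ L ∈ T, L.card = k + 1) ∧ IsIndep a T} := by
    rw [heq]
    exact ⟨hc, hind T hc hT⟩
  exact this.2

end Discriminantal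

theorem mainTheorem2 (n k : ℕ) (hk : 1 ≤ k) (hkn : k < n)
    (a : Fin n → Fin k → ℂ) (ha : Discriminantal.IsCentralGeneric a)
    (X : Submodule ℂ (Fin n → ℂ)) (hX : X ∈ Discriminantal.intersectionLattice a)
    (r : ℕ) (hsimple : Discriminantal.IsSimpleIntersection a X r)
    (hrank : Discriminantal.rank X < r) :
    ¬ Discriminantal.IsVeryGeneric a := by
  intro hvg
  obtain ⟨T, rfl, hc, rfl, hne⟩ := hsimple
  have hind : ∀ T : Finset (Finset (Fin n)), (∀ L ∈ T, L.card = k + 1) →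
      Discriminantal.IsHall k T → Discriminantal.IsIndep a T :=
    fun T hc hT => hvg.isIndep_of_isHall hkn ha hc hT
  have hT : ¬ Discriminantal.IsHall k T :=
    fun h => absurd (hind T hc h).card_le_rank (not_le.2 hrank)
  obtain ⟨J, hJ, h2, S, hS, heq⟩ := ha.exists_inter_eq_flat hind hc hT
  exact hne J hJ h2 S hS heq
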